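/- Let $F$ be a field and $p$ a prime number. Let $M_{p^\infty}(F)=\varinjlim_k M_{p^k}(F)$ be the direct limit of the matrix algebras $M_{p^k}(F)$ ($k\ge 0$) along the unital diagonal embeddings $M_{p^i}(F)\to M_{p^j}(F)$, $a\mapsto\operatorname{diag}(a,\dots,a)$, $i\le j$. In the $F$-algebra of row- and column-finite matrices over $F$ with rows and columns indexed by $\mathbb N$, call a matrix finite if it has only finitely many nonzero entries, and $p^\infty$-recurrent if it has the form $a\oplus a\oplus a\oplus\cdots$ for some $k\ge 0$ and some $a\in M_{p^k}(F)$. Let $A=T(F)$ be the set of all sums of a finite matrix and a $p^\infty$-recurrent matrix; it is a unital subalgebra. Then, as $F$-algebras, $$M_p(F)\otimes_F A\;\cong\; M_p(A)\;\cong\; A,\qquad\text{but}\qquad M_{p^\infty}(F)\otimes_F A\;\not\cong\; A.$$ In particular, for a unital $F$-algebra $A$ the condition $(c_1)$: $M_p(F)\otimes_F A\cong A$ does not imply the condition $(c_1^*)$: $M_{p^\infty}(F)\otimes_F A\cong A$. -/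

import Mathlib

open scoped TensorProduct

noncomputable section

namespace Supernatural

section Repeat

variable {R : Type*} [Ring R]

/-- The `(i, j)` entry of the block diagonal matrix `a ⊕ a ⊕ ⋯` with all blocks equal to the
`n × n` matrix `a` (`Fin.ofNat n i` is the residue of `i` modulo `n`). -/
def repeatEntry (n : ℕ) [NeZero n] (a : Matrix (Fin n) (Fin n) R) (i j : ℕ) : R :=
  if i / n = j / n then a (Fin.ofNat n i) (Fin.ofNat n j) else 0

theorem repeatEntry_add (n : ℕ) [NeZero n] (a b : Matrix (Fin n) (Fin n) R) (i j : ℕ) :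
    repeatEntry n (a + b) i j = repeatEntry n a i j + repeatEntry n b i j := by
  unfold repeatEntry; split_ifs <;> simp

/-- The indices lying in the same block of length `n` as `i`. -/
def block (n i : ℕ) : Finset ℕ := (Finset.range n).image (fun r => n * (i / n) + r)

theorem mem_block (n i j : ℕ) [NeZero n] : j ∈ block n i ↔ i / n = j / n := by
  have hn : 0 < n := NeZero.pos n
  simp only [block, Finset.mem_image, Finset.mem_range]
  constructor
  · rintro ⟨r, hr, rfl⟩
    rw [Nat.mul_add_div hn, Nat.div_eq_of_lt hr, add_zero]
  · intro h
    exact ⟨j % n, Nat.mod_lt _ hn, by rw [h]; exact Nat.div_add_mod j n⟩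

theorem repeatEntry_mul (n : ℕ) [NeZero n] (a b : Matrix (Fin n) (Fin n) R) (i k : ℕ)
    (s : Finset ℕ) (hs : ∀ j, i / n = j / n → j ∈ s) :
    ∑ j ∈ s, repeatEntry n a i j * repeatEntry n b j k = repeatEntry n (a * b) i k := by
  have hn : 0 < n := NeZero.pos n
  have hsub : block n i ⊆ s := fun j hj => hs j ((mem_block n i j).1 hj)
  rw [← Finset.sum_subset hsub]
  · rw [block, Finset.sum_image (fun x _ y _ h => Nat.add_left_cancel h), Finset.sum_range]
    have h1 : ∀ r : Fin n, (n * (i / n) + r) / n = i / n := fun r => by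
      rw [Nat.mul_add_div hn, Nat.div_eq_of_lt r.2, add_zero]
    have h2 : ∀ r : Fin n, Fin.ofNat n (n * (i / n) + r) = r := fun r => by
      apply Fin.ext; simp [Fin.ofNat, Nat.mod_eq_of_lt r.2]
    simp only [repeatEntry, h1, h2, if_true]
    split_ifs
    · rw [Matrix.mul_apply]
    · simp
  · intro j _ hj
    rw [mem_block] at hj
    simp [repeatEntry, hj]

/-- The diagonal map `M_n(R) → M_N(R)`, `a ↦ diag(a, …, a)` (used when `n ∣ N`). -/
def diagMatrix (n N : ℕ) [NeZero n] (a : Matrix (Fin n) (Fin n) R) : Matrix (Fin N) (Fin N) R :=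
  Matrix.of fun i j => repeatEntry n a i j

theorem repeatEntry_diagMatrix (n N : ℕ) [NeZero n] [NeZero N] (h : n ∣ N)
    (a : Matrix (Fin n) (Fin n) R) (i j : ℕ) :
    repeatEntry N (diagMatrix n N a) i j = repeatEntry n a i j := by
  obtain ⟨m, rfl⟩ := h
  have hmod : ∀ x : ℕ, Fin.ofNat n (x % (n * m)) = Fin.ofNat n x := fun x => by
    apply Fin.ext; simp [Fin.ofNat]
  have hdiv : ∀ x : ℕ, x % (n * m) / n = x / n % m := fun x => Nat.mod_mul_right_div_self x n m
  simp only [repeatEntry, diagMatrix, Matrix.of_apply, Fin.val_ofNat, hmod, hdiv,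
    ← Nat.div_div_eq_div_mul]
  by_cases hij : i / n = j / n
  · simp [hij]
  · by_cases h' : i / n / m = j / n / m
    · have : i / n % m ≠ j / n % m := fun h'' => hij (by
        rw [← Nat.div_add_mod (i / n) m, ← Nat.div_add_mod (j / n) m, h', h''])
      simp [hij, h', this]
    · simp [hij, h']

theorem repeatEntry_algebraMap (F : Type*) [CommRing F] [Algebra F R] (n : ℕ) [NeZero n] (c : F)
    (i j : ℕ) :
    repeatEntry n (algebraMap F (Matrix (Fin n) (Fin n) R) c) i j
      = if i = j then algebraMap F R c else 0 := by
  simp only [repeatEntry, Matrix.algebraMap_matrix_apply, Fin.ext_iff, Fin.val_ofNat]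
  by_cases hij : i = j
  · simp [hij]
  · rw [if_neg hij]
    split_ifs with h1 h2
    · exact absurd (by rw [← Nat.div_add_mod i n, ← Nat.div_add_mod j n, h1, h2]) hij
    · rfl
    · rfl

/-- The diagonal embedding `M_n(R) → M_N(R)`, for `n ∣ N`, as a homomorphism of algebras. -/
def diagHom (F : Type*) [CommRing F] [Algebra F R] (n N : ℕ) [NeZero n] [NeZero N] (h : n ∣ N) :
    Matrix (Fin n) (Fin n) R →ₐ[F] Matrix (Fin N) (Fin N) R where
  toFun := diagMatrix n N
  map_one' := by
    ext i j
    have := repeatEntry_algebraMap (R := R) F n 1 i j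
    simpa [diagMatrix, Matrix.one_apply, Fin.ext_iff] using this
  map_mul' a b := by
    ext i k
    obtain ⟨m, rfl⟩ := h
    simp only [diagMatrix, Matrix.mul_apply, Matrix.of_apply]
    rw [← repeatEntry_mul n a b i k (Finset.range (n * m)), Finset.sum_range]
    intro j hj
    rw [Finset.mem_range, mul_comm, ← Nat.div_lt_iff_lt_mul (NeZero.pos n), ← hj,
      Nat.div_lt_iff_lt_mul (NeZero.pos n)]
    exact i.2.trans_eq (mul_comm n m)
  map_zero' := by ext i j; simp [diagMatrix, repeatEntry]
  map_add' a b := by ext i j; simp [diagMatrix, repeatEntry_add]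
  commutes' c := by
    ext i j
    have := repeatEntry_algebraMap (R := R) F n c i j
    simpa [diagMatrix, Matrix.algebraMap_matrix_apply, Fin.ext_iff] using this

end Repeat

section SupernaturalMatrices

variable (F : Type*) [CommRing F] (p : ℕ) [NeZero p]

/-- The transition map `M_{p^i}(F) → M_{p^j}(F)`, `a ↦ diag(a, …, a)`, for `i ≤ j`. -/
def transition (i j : ℕ) (h : i ≤ j) :
    Matrix (Fin (p ^ i)) (Fin (p ^ i)) F →ₐ[F] Matrix (Fin (p ^ j)) (Fin (p ^ j)) F :=
  diagHom F (p ^ i) (p ^ j) (pow_dvd_pow p h)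

instance : DirectedSystem (fun k => Matrix (Fin (p ^ k)) (Fin (p ^ k)) F)
    (transition F p · · ·) where
  map_self i a := by
    ext x y
    change repeatEntry (p ^ i) a x y = a x y
    simp [repeatEntry, Nat.div_eq_of_lt x.2, Nat.div_eq_of_lt y.2]
  map_map k j i hij hjk a := by
    ext x y
    exact repeatEntry_diagMatrix _ _ (pow_dvd_pow p hij) a x y

/-- The supernatural matrix algebra `M_{p^∞}(F)`: the direct limit of the matrix algebras
`M_{p^k}(F)`, `k = 0, 1, 2, …`, along the diagonal embeddings. -/
abbrev SupernaturalMatrix : Type _ :=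
  DirectLimit (fun k => Matrix (Fin (p ^ k)) (Fin (p ^ k)) F) (transition F p)

end SupernaturalMatrices

section RowColumnFinite

/-- The row- and column-finite matrices over `R`, with rows and columns indexed by `ℕ`. -/
def RCFMatrix (R : Type*) [Ring R] : Type _ :=
  {M : Matrix ℕ ℕ R // (∀ i, {j | M i j ≠ 0}.Finite) ∧ (∀ j, {i | M i j ≠ 0}.Finite)}

namespace RCFMatrix

variable {R : Type*} [Ring R]

/-- The underlying infinite matrix. -/
def entry (x : RCFMatrix R) : Matrix ℕ ℕ R := x.1

@[ext]
theorem ext {x y : RCFMatrix R} (h : ∀ i j, x.entry i j = y.entry i j) : x = y :=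
  Subtype.ext (funext fun i => funext fun j => h i j)

theorem entry_injective : Function.Injective (entry : RCFMatrix R → Matrix ℕ ℕ R) :=
  Subtype.val_injective

theorem row_finite (x : RCFMatrix R) (i : ℕ) : {j | x.entry i j ≠ 0}.Finite := x.2.1 i

theorem col_finite (x : RCFMatrix R) (j : ℕ) : {i | x.entry i j ≠ 0}.Finite := x.2.2 j

instance : Zero (RCFMatrix R) := ⟨⟨0, by simp, by simp⟩⟩

instance : One (RCFMatrix R) :=
  ⟨⟨1, fun i => (Set.finite_singleton i).subset fun j hj => by
      by_contra h; exact hj (Matrix.one_apply_ne (fun e => h e.symm)),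
    fun j => (Set.finite_singleton j).subset fun i hi => by
      by_contra h; exact hi (Matrix.one_apply_ne h)⟩⟩

instance : Add (RCFMatrix R) :=
  ⟨fun x y => ⟨x.entry + y.entry,
    fun i => ((x.row_finite i).union (y.row_finite i)).subset fun j hj => by
      by_contra h; simp only [Set.mem_union, Set.mem_ofPred_eq, not_or, not_not] at h
      exact hj (by simp [h.1, h.2]),
    fun j => ((x.col_finite j).union (y.col_finite j)).subset fun i hi => by
      by_contra h; simp only [Set.mem_union, Set.mem_ofPred_eq, not_or, not_not] at h
      exact hi (by simp [h.1, h.2])⟩⟩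

instance : Neg (RCFMatrix R) :=
  ⟨fun x => ⟨-x.entry, fun i => (x.row_finite i).subset fun j hj => by simpa using hj,
    fun j => (x.col_finite j).subset fun i hi => by simpa using hi⟩⟩

instance : Sub (RCFMatrix R) :=
  ⟨fun x y => ⟨x.entry - y.entry, by
    have h := (x + -y).2
    have e : (x + -y).1 = x.entry - y.entry := (sub_eq_add_neg _ _).symm
    rwa [e] at h⟩⟩

instance {S : Type*} [SMulZeroClass S R] : SMul S (RCFMatrix R) :=
  ⟨fun c x => ⟨c • x.entry,
    fun i => (x.row_finite i).subset fun j hj h => hj (by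
      rw [Matrix.smul_apply, h, smul_zero]),
    fun j => (x.col_finite j).subset fun i hi h => hi (by
      rw [Matrix.smul_apply, h, smul_zero])⟩⟩

theorem exists_of_finsum_ne (x y : RCFMatrix R) {i k : ℕ}
    (h : ∑ᶠ j, x.entry i j * y.entry j k ≠ 0) : ∃ j, x.entry i j ≠ 0 ∧ y.entry j k ≠ 0 := by
  by_contra hne
  refine h (finsum_eq_zero_of_forall_eq_zero fun j => ?_)
  by_cases h1 : x.entry i j = 0
  · rw [h1, zero_mul]
  · by_cases h2 : y.entry j k = 0
    · rw [h2, mul_zero]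
    · exact absurd ⟨j, h1, h2⟩ hne

/-- The usual product of row- and column-finite matrices (each sum has finite support). -/
instance : Mul (RCFMatrix R) :=
  ⟨fun x y => ⟨fun i k => ∑ᶠ j, x.entry i j * y.entry j k,
    fun i => ((x.row_finite i).biUnion fun j _ => y.row_finite j).subset fun k hk => by
      obtain ⟨j, h1, h2⟩ := exists_of_finsum_ne x y hk
      exact Set.mem_biUnion (show j ∈ {j | x.entry i j ≠ 0} from h1) h2,
    fun k => ((y.col_finite k).biUnion fun j _ => x.col_finite j).subset fun i hi => by
      obtain ⟨j, h1, h2⟩ := exists_of_finsum_ne x y hi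
      exact Set.mem_biUnion (show j ∈ {j | y.entry j k ≠ 0} from h2) h1⟩⟩

@[simp] theorem entry_zero (i j : ℕ) : (0 : RCFMatrix R).entry i j = 0 := rfl

theorem entry_one (i j : ℕ) : (1 : RCFMatrix R).entry i j = if i = j then 1 else 0 :=
  Matrix.one_apply

@[simp] theorem entry_add (x y : RCFMatrix R) (i j : ℕ) :
    (x + y).entry i j = x.entry i j + y.entry i j := rfl

@[simp] theorem entry_smul {S : Type*} [SMulZeroClass S R] (c : S) (x : RCFMatrix R) (i j : ℕ) :
    (c • x).entry i j = c • x.entry i j := rfl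

theorem entry_mul (x y : RCFMatrix R) (i k : ℕ) :
    (x * y).entry i k = ∑ᶠ j, x.entry i j * y.entry j k := rfl

theorem entry_mul_eq_sum (x y : RCFMatrix R) (i k : ℕ) (s : Finset ℕ)
    (hs : ∀ j, x.entry i j ≠ 0 → y.entry j k ≠ 0 → j ∈ s) :
    (x * y).entry i k = ∑ j ∈ s, x.entry i j * y.entry j k := by
  rw [entry_mul]
  refine finsum_eq_sum_of_support_subset _ fun j hj => ?_
  exact hs j (left_ne_zero_of_mul hj) (right_ne_zero_of_mul hj)

instance : AddCommGroup (RCFMatrix R) :=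
  Function.Injective.addCommGroup entry entry_injective rfl (fun _ _ => rfl) (fun _ => rfl)
    (fun _ _ => rfl) (fun _ _ => rfl) (fun _ _ => rfl)

instance : Ring (RCFMatrix R) where
  __ := (inferInstance : AddCommGroup (RCFMatrix R))
  zero_mul x := by ext i k; simp [entry_mul]
  mul_zero x := by ext i k; simp [entry_mul]
  one_mul x := by
    ext i k
    rw [entry_mul_eq_sum 1 x i k {i}]
    · simp [entry_one]
    · intro j hj _
      rw [entry_one] at hj
      by_contra h
      exact hj (if_neg fun e => h (by simp [e]))
  mul_one x := by
    ext i k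
    rw [entry_mul_eq_sum x 1 i k {k}]
    · simp [entry_one]
    · intro j _ hj
      rw [entry_one] at hj
      by_contra h
      exact hj (if_neg fun e => h (by simp [e]))
  left_distrib x y z := by
    ext i k
    have hs : ∀ j, x.entry i j ≠ 0 → j ∈ (x.row_finite i).toFinset := fun j hj => by simpa using hj
    rw [entry_add, entry_mul_eq_sum x _ i k _ (fun j hj _ => hs j hj),
      entry_mul_eq_sum x y i k _ (fun j hj _ => hs j hj),
      entry_mul_eq_sum x z i k _ (fun j hj _ => hs j hj), ← Finset.sum_add_distrib]
    exact Finset.sum_congr rfl fun j _ => mul_add _ _ _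
  right_distrib x y z := by
    ext i k
    have hs : ∀ j, z.entry j k ≠ 0 → j ∈ (z.col_finite k).toFinset := fun j hj => by simpa using hj
    rw [entry_add, entry_mul_eq_sum _ z i k _ (fun j _ hj => hs j hj),
      entry_mul_eq_sum x z i k _ (fun j _ hj => hs j hj),
      entry_mul_eq_sum y z i k _ (fun j _ hj => hs j hj), ← Finset.sum_add_distrib]
    exact Finset.sum_congr rfl fun j _ => add_mul _ _ _
  mul_assoc x y z := by
    ext i l
    have hs : ∀ j, x.entry i j ≠ 0 → j ∈ (x.row_finite i).toFinset := fun j hj => by simpa using hj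
    have ht : ∀ k, z.entry k l ≠ 0 → k ∈ (z.col_finite l).toFinset := fun k hk => by simpa using hk
    rw [entry_mul_eq_sum _ z i l _ (fun k _ hk => ht k hk),
      entry_mul_eq_sum x _ i l _ (fun j hj _ => hs j hj)]
    simp only [fun k => entry_mul_eq_sum x y i k _ (fun j hj _ => hs j hj),
      fun j => entry_mul_eq_sum y z j l _ (fun k _ hk => ht k hk), Finset.sum_mul, Finset.mul_sum]
    rw [Finset.sum_comm]
    simp only [mul_assoc]

section Algebra

variable {F : Type*} [CommRing F] [Algebra F R]

instance : Module F (RCFMatrix R) :=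
  Function.Injective.module F (⟨⟨entry, rfl⟩, fun _ _ => rfl⟩ : RCFMatrix R →+ Matrix ℕ ℕ R)
    entry_injective (fun _ _ => rfl)

instance : Algebra F (RCFMatrix R) :=
  Algebra.ofModule
    (fun c x y => by
      ext i k
      have hs : ∀ j, x.entry i j ≠ 0 → j ∈ (x.row_finite i).toFinset := fun j hj => by
        simpa using hj
      have hs' : ∀ j, (c • x).entry i j ≠ 0 → j ∈ (x.row_finite i).toFinset := fun j hj =>
        hs j fun h => hj (by simp [h])
      rw [entry_smul, entry_mul_eq_sum _ y i k _ (fun j hj _ => hs' j hj),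
        entry_mul_eq_sum x y i k _ (fun j hj _ => hs j hj), Finset.smul_sum]
      exact Finset.sum_congr rfl fun j _ => smul_mul_assoc _ _ _)
    (fun c x y => by
      ext i k
      have hs : ∀ j, x.entry i j ≠ 0 → j ∈ (x.row_finite i).toFinset := fun j hj => by
        simpa using hj
      rw [entry_smul, entry_mul_eq_sum x _ i k _ (fun j hj _ => hs j hj),
        entry_mul_eq_sum x y i k _ (fun j hj _ => hs j hj), Finset.smul_sum]
      exact Finset.sum_congr rfl fun j _ => mul_smul_comm _ _ _)

theorem entry_algebraMap (c : F) (i j : ℕ) :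
    (algebraMap F (RCFMatrix R) c).entry i j = if i = j then algebraMap F R c else 0 := by
  rw [Algebra.algebraMap_eq_smul_one, entry_smul, entry_one, Algebra.algebraMap_eq_smul_one]
  split_ifs <;> simp

/-- A finite matrix: only finitely many entries are nonzero. -/
def IsFinite (x : RCFMatrix R) : Prop := {q : ℕ × ℕ | x.entry q.1 q.2 ≠ 0}.Finite

theorem IsFinite.add {x y : RCFMatrix R} (hx : x.IsFinite) (hy : y.IsFinite) :
    (x + y).IsFinite :=
  (hx.union hy).subset fun q hq => by
    by_contra h; simp only [Set.mem_union, Set.mem_ofPred_eq, not_or, not_not] at h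
    exact hq (by simp [h.1, h.2])

theorem IsFinite.mul_right {x : RCFMatrix R} (hx : x.IsFinite) (y : RCFMatrix R) :
    (x * y).IsFinite :=
  (hx.biUnion fun q _ => (Set.finite_singleton q.1).prod (y.row_finite q.2)).subset
    fun q hq => by
      obtain ⟨j, h1, h2⟩ := exists_of_finsum_ne x y hq
      exact Set.mem_biUnion (show (q.1, j) ∈ {q : ℕ × ℕ | x.entry q.1 q.2 ≠ 0} from h1) ⟨rfl, h2⟩

theorem IsFinite.mul_left {y : RCFMatrix R} (hy : y.IsFinite) (x : RCFMatrix R) :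
    (x * y).IsFinite :=
  (hy.biUnion fun q _ => (x.col_finite q.1).prod (Set.finite_singleton q.2)).subset
    fun q hq => by
      obtain ⟨j, h1, h2⟩ := exists_of_finsum_ne x y hq
      exact Set.mem_biUnion (show (j, q.2) ∈ {q : ℕ × ℕ | y.entry q.1 q.2 ≠ 0} from h2) ⟨h1, rfl⟩

theorem IsFinite.zero : (0 : RCFMatrix R).IsFinite := by simp [IsFinite]

/-- A `p^∞`-recurrent matrix: `x = a ⊕ a ⊕ ⋯` for a matrix `a` whose size is a natural divisor
`p ^ k` of `p^∞`. -/
def IsRecurrent (p : ℕ) [NeZero p] (x : RCFMatrix R) : Prop :=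
  ∃ (k : ℕ) (a : Matrix (Fin (p ^ k)) (Fin (p ^ k)) R), ∀ i j,
    x.entry i j = repeatEntry (p ^ k) a i j

theorem IsRecurrent.exists_common {p : ℕ} [NeZero p] {x y : RCFMatrix R}
    (hx : x.IsRecurrent p) (hy : y.IsRecurrent p) :
    ∃ (k : ℕ) (a b : Matrix (Fin (p ^ k)) (Fin (p ^ k)) R),
      (∀ i j, x.entry i j = repeatEntry (p ^ k) a i j) ∧
      (∀ i j, y.entry i j = repeatEntry (p ^ k) b i j) := by
  obtain ⟨k, a, ha⟩ := hx
  obtain ⟨l, b, hb⟩ := hy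
  refine ⟨max k l, diagMatrix _ _ a, diagMatrix _ _ b, fun i j => ?_, fun i j => ?_⟩
  · rw [ha, repeatEntry_diagMatrix _ _ (pow_dvd_pow p (le_max_left k l))]
  · rw [hb, repeatEntry_diagMatrix _ _ (pow_dvd_pow p (le_max_right k l))]

theorem IsRecurrent.add {p : ℕ} [NeZero p] {x y : RCFMatrix R}
    (hx : x.IsRecurrent p) (hy : y.IsRecurrent p) : (x + y).IsRecurrent p := by
  obtain ⟨k, a, b, ha, hb⟩ := hx.exists_common hy
  exact ⟨k, a + b, fun i j => by rw [entry_add, ha, hb, repeatEntry_add]⟩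

theorem IsRecurrent.mul {p : ℕ} [NeZero p] {x y : RCFMatrix R}
    (hx : x.IsRecurrent p) (hy : y.IsRecurrent p) : (x * y).IsRecurrent p := by
  obtain ⟨k, a, b, ha, hb⟩ := hx.exists_common hy
  refine ⟨k, a * b, fun i l => ?_⟩
  rw [entry_mul_eq_sum x y i l (block (p ^ k) i)]
  · simp only [ha, hb]
    exact repeatEntry_mul _ a b i l _ fun j hj => (mem_block _ i j).2 hj
  · intro j hj _
    rw [ha] at hj
    rw [mem_block]
    by_contra h
    exact hj (if_neg h)

theorem isRecurrent_algebraMap (p : ℕ) [NeZero p] (c : F) :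
    (algebraMap F (RCFMatrix R) c).IsRecurrent p :=
  ⟨0, algebraMap F _ c, fun i j => by rw [entry_algebraMap, repeatEntry_algebraMap]⟩

end Algebra

end RCFMatrix

open RCFMatrix in
/-- `T(R)`: the sum, inside the algebra of row- and column-finite matrices over `R`, of the
ideal of finite matrices and the subalgebra of `p^∞`-recurrent matrices. -/
def T (F : Type*) [CommRing F] (p : ℕ) [NeZero p] (R : Type*) [Ring R] [Algebra F R] :
    Subalgebra F (RCFMatrix R) where
  carrier := {x | ∃ a b : RCFMatrix R, a.IsFinite ∧ b.IsRecurrent p ∧ x = a + b}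
  mul_mem' := by
    rintro _ _ ⟨a, b, ha, hb, rfl⟩ ⟨c, d, hc, hd, rfl⟩
    refine ⟨a * (c + d) + b * c, b * d, (ha.mul_right _).add (hc.mul_left _), hb.mul hd, ?_⟩
    rw [add_mul, mul_add b, add_assoc]
  add_mem' := by
    rintro _ _ ⟨a, b, ha, hb, rfl⟩ ⟨c, d, hc, hd, rfl⟩
    exact ⟨a + c, b + d, ha.add hc, hb.add hd, add_add_add_comm a b c d⟩
  algebraMap_mem' c := ⟨0, _, IsFinite.zero, isRecurrent_algebraMap p c, (zero_add _).symm⟩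

end RowColumnFinite

end Supernatural

end

open scoped TensorProduct Kronecker

noncomputable section

namespace Supernatural

/-! ### Euclidean division of indices `r + n * i`. -/

section DivMod

/-! Sorting rows and columns by residue modulo p turns an infinite matrix into a p × p matrix of
infinite matrices, and this respects products. Finite matrices have finite components, and
p^∞-recurrent ones have p^∞-recurrent components; both statements also hold for the inverse
construction. Hence T(F) ≅ M_p(T(F)), and M_p(F) ⊗ T(F) is the same algebra (`componentEquiv`).

The invariant separating T(F) from M_{p^∞}(F) ⊗ T(F) is a nonzero idempotent e with eAe = Fe. The
matrix unit at (0, 0) is one in T(F). In M_{p^∞}(F) ⊗ A there is none, for any A: e involves only a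
finite stage M_{p^k}(F), so it commutes with the copy of M_p(F) centralizing that stage inside
M_{p^(k+1)}(F) (`exists_stage_commute`, `commute_commutantHom`). Then b ↦ be would be a unital
homomorphism from M_p(F) to eAe = F, impossible as p ≥ 2 (`IsRankOneIdempotent.not_commute_matrix`).
-/

theorem add_mul_div_left (n : ℕ) (r : Fin n) (i : ℕ) : (r + n * i) / n = i := by
  rw [Nat.add_mul_div_left _ _ r.pos, Nat.div_eq_of_lt r.2, zero_add]

theorem add_mul_mod_left (n : ℕ) (r : Fin n) (i : ℕ) : (r + n * i) % n = r := by
  rw [Nat.add_mul_mod_self_left, Nat.mod_eq_of_lt r.2]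

theorem add_mul_div_mul_left (n m : ℕ) (r : Fin n) (i : ℕ) : (r + n * i) / (m * n) = i / m := by
  rw [mul_comm m, ← Nat.div_div_eq_div_mul, add_mul_div_left]

theorem add_mul_injective (n : ℕ) (r : Fin n) : Function.Injective fun i : ℕ => r + n * i :=
  fun _ _ h => Nat.eq_of_mul_eq_mul_left r.pos (Nat.add_left_cancel h)

end DivMod

/-! ### Splitting an infinite matrix by residues modulo n. -/

namespace RCFMatrix

variable {R : Type*} [Ring R] (n : ℕ)

/-- The `(r, s)` component of an infinite matrix: the submatrix on the rows congruent to `r` and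
the columns congruent to `s` modulo `n`. -/
def component (r s : Fin n) (x : RCFMatrix R) : RCFMatrix R :=
  ⟨fun i j => x.entry (r + n * i) (s + n * j),
    fun i => (x.row_finite (r + n * i)).preimage (add_mul_injective n s).injOn,
    fun j => (x.col_finite (s + n * j)).preimage (add_mul_injective n r).injOn⟩

@[simp] theorem entry_component (r s : Fin n) (x : RCFMatrix R) (i j : ℕ) :
    (component n r s x).entry i j = x.entry (r + n * i) (s + n * j) := rfl

/-- Block multiplication: the inner summation index is written as `t + n * j` and the sum is grouped
by the residue `t`. -/
theorem component_mul (r s : Fin n) (x y : RCFMatrix R) :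
    component n r s (x * y) = ∑ t, component n r t x * component n t s y := by
  ext i k
  obtain ⟨N, hN⟩ := (x.row_finite (r + n * i)).bddAbove
  have hN' : ∀ j, x.entry (r + n * i) j ≠ 0 → j < N + 1 := fun j hj => Nat.lt_succ_of_le (hN hj)
  let entryHom : RCFMatrix R →+ R := ⟨⟨fun z => z.entry i k, rfl⟩, fun _ _ => rfl⟩
  have hsum : (∑ t, component n r t x * component n t s y).entry i k
      = ∑ t, (component n r t x * component n t s y).entry i k := map_sum entryHom _ _
  -- Row `r + n * i` of `x` vanishes from column `N + 1` on. The longer range `(N + 1) * n` splits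
  -- exactly into `n` residues and `N + 1` quotients, as `finProdFinEquiv` requires.
  rw [hsum, entry_component, entry_mul_eq_sum x y _ _ (Finset.range ((N + 1) * n))
    (fun j hj _ => Finset.mem_range.2 ((hN' j hj).trans_le (Nat.le_mul_of_pos_right _ r.pos)))]
  have hcomp : ∀ t : Fin n, (component n r t x * component n t s y).entry i k
      = ∑ j : Fin (N + 1), x.entry (r + n * i) (t + n * j) * y.entry (t + n * j) (s + n * k) :=
    fun t => by
      rw [entry_mul_eq_sum _ _ i k (Finset.range (N + 1)), Finset.sum_range]
      · rfl
      · intro j hj _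
        have h1 : t + n * j < N + 1 := hN' _ hj
        have h2 : j ≤ n * j := Nat.le_mul_of_pos_left j r.pos
        exact Finset.mem_range.2 (by lia)
  simp only [hcomp]
  rw [Finset.sum_range, ← finProdFinEquiv.sum_comp, Fintype.sum_prod_type, Finset.sum_comm]
  rfl

/-- The infinite matrix whose `(r, s)` component is `x` and whose other components vanish. -/
def inflate (r s : Fin n) (x : RCFMatrix R) : RCFMatrix R :=
  ⟨fun i j => if i % n = r ∧ j % n = s then x.entry (i / n) (j / n) else 0,
    fun i => ((x.row_finite (i / n)).image fun j => s + n * j).subset fun j hj => by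
      have hj := ite_ne_right_iff.1 hj
      exact ⟨j / n, hj.2, by rw [← hj.1.2]; exact Nat.mod_add_div j n⟩,
    fun j => ((x.col_finite (j / n)).image fun i => r + n * i).subset fun i hi => by
      have hi := ite_ne_right_iff.1 hi
      exact ⟨i / n, hi.2, by rw [← hi.1.1]; exact Nat.mod_add_div i n⟩⟩

theorem entry_inflate (r s : Fin n) (x : RCFMatrix R) (i j : ℕ) :
    (inflate n r s x).entry i j
      = if i % n = r ∧ j % n = s then x.entry (i / n) (j / n) else 0 := rfl

theorem inflate_add (r s : Fin n) (x y : RCFMatrix R) :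
    inflate n r s (x + y) = inflate n r s x + inflate n r s y := by
  ext i j
  simp only [entry_inflate, entry_add]
  split_ifs <;> simp

theorem component_inflate (r s r' s' : Fin n) (x : RCFMatrix R) :
    component n r' s' (inflate n r s x) = Matrix.single r s x r' s' := by
  ext i j
  rw [entry_component, entry_inflate, add_mul_mod_left, add_mul_mod_left, add_mul_div_left,
    add_mul_div_left, Matrix.single_apply]
  simp only [Fin.val_inj, eq_comm (a := r), eq_comm (a := s)]
  split_ifs <;> rfl

theorem IsFinite.component {x : RCFMatrix R} (hx : x.IsFinite) (r s : Fin n) :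
    (component n r s x).IsFinite :=
  hx.preimage (f := Prod.map (fun i => r + n * i) fun j => s + n * j)
    ((add_mul_injective n r).prodMap (add_mul_injective n s)).injOn

theorem IsFinite.inflate {x : RCFMatrix R} (hx : x.IsFinite) (r s : Fin n) :
    (inflate n r s x).IsFinite :=
  (hx.image (Prod.map (fun i => r + n * i) fun j => s + n * j)).subset fun q hq => by
    have hq := ite_ne_right_iff.1 hq
    refine ⟨(q.1 / n, q.2 / n), hq.2, Prod.ext ?_ ?_⟩
    · change r + n * (q.1 / n) = q.1
      rw [← hq.1.1]; exact Nat.mod_add_div _ _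
    · change s + n * (q.2 / n) = q.2
      rw [← hq.1.2]; exact Nat.mod_add_div _ _

variable (p : ℕ) [NeZero p]

/-- A block of size `p ^ k` is first repeated to size `p ^ (k + 1)`, a multiple of `p` even when `k
= 0`; its residue components then have size `p ^ k` and repeat. -/
theorem IsRecurrent.component {x : RCFMatrix R} (hx : x.IsRecurrent p) (r s : Fin p) :
    (component p r s x).IsRecurrent p := by
  obtain ⟨k, a, ha⟩ := hx
  refine ⟨k, Matrix.of fun u v => diagMatrix (p ^ k) (p ^ (k + 1)) a
    (Fin.ofNat _ (r + p * u)) (Fin.ofNat _ (s + p * v)), fun i j => ?_⟩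
  have hmod : ∀ (t : Fin p) (l : ℕ), Fin.ofNat (p ^ (k + 1)) (t + p * (Fin.ofNat (p ^ k) l))
      = Fin.ofNat (p ^ (k + 1)) (t + p * l) := fun t l => by
    apply Fin.ext
    simp only [Fin.val_ofNat, pow_succ']
    exact (Nat.ModEq.mul_left' p (Nat.mod_modEq l (p ^ k))).add_left _
  rw [entry_component, ha, ← repeatEntry_diagMatrix _ (p ^ (k + 1)) (pow_dvd_pow p k.le_succ)]
  simp only [repeatEntry, Matrix.of_apply, hmod]
  simp only [pow_succ, add_mul_div_mul_left]

/-- Spreading the entries out by a factor `p` multiplies the period by `p`, so the new block has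
size `p ^ (k + 1)`. -/
theorem IsRecurrent.inflate {x : RCFMatrix R} (hx : x.IsRecurrent p) (r s : Fin p) :
    (inflate p r s x).IsRecurrent p := by
  obtain ⟨k, a, ha⟩ := hx
  refine ⟨k + 1, Matrix.of fun u v => if u % p = r ∧ v % p = s then
    a (Fin.ofNat _ (u / p)) (Fin.ofNat _ (v / p)) else 0, fun i j => ?_⟩
  have hmod : ∀ l : ℕ, (Fin.ofNat (p ^ (k + 1)) l : ℕ) % p = l % p := fun l =>
    Nat.mod_mod_of_dvd l (dvd_pow_self p k.succ_ne_zero)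
  have hdiv : ∀ l : ℕ, Fin.ofNat (p ^ k) ((Fin.ofNat (p ^ (k + 1)) l : ℕ) / p)
      = Fin.ofNat (p ^ k) (l / p) := fun l => by
    apply Fin.ext
    simp only [Fin.val_ofNat, pow_succ']
    rw [Nat.mod_mul_right_div_self, Nat.mod_mod]
  rw [entry_inflate, ha]
  simp only [repeatEntry, Matrix.of_apply, hmod, hdiv, pow_succ', ← Nat.div_div_eq_div_mul]
  split_ifs <;> rfl

end RCFMatrix

/-! ### The isomorphism T(R) ≅ M_p(T(R)). -/

section Components

open RCFMatrix

variable (F : Type*) [CommRing F] (p : ℕ) [NeZero p] {R : Type*} [Ring R] [Algebra F R]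

theorem component_mem_T {x : RCFMatrix R} (hx : x ∈ T F p R) (r s : Fin p) :
    component p r s x ∈ T F p R := by
  obtain ⟨a, b, ha, hb, rfl⟩ := hx
  exact ⟨_, _, ha.component p r s, hb.component p r s, rfl⟩

theorem inflate_mem_T {x : RCFMatrix R} (hx : x ∈ T F p R) (r s : Fin p) :
    inflate p r s x ∈ T F p R := by
  obtain ⟨a, b, ha, hb, rfl⟩ := hx
  exact ⟨_, _, ha.inflate p r s, hb.inflate p r s, inflate_add p r s a b⟩

variable (R) in
/-- The homomorphism `T(R) → M_p(T(R))` sending a matrix to its components modulo `p`. -/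
def componentHom : T F p R →ₐ[F] Matrix (Fin p) (Fin p) (T F p R) :=
  AlgHom.ofLinearMap
    { toFun := fun x => Matrix.of fun r s => ⟨component p r s x.1, component_mem_T F p x.2 r s⟩
      map_add' := fun _ _ => rfl
      map_smul' := fun _ _ => rfl }
    (by
      ext r s i j
      change (1 : RCFMatrix R).entry (r + p * i) (s + p * j)
        = ((1 : Matrix (Fin p) (Fin p) (T F p R)) r s).1.entry i j
      rw [entry_one, Matrix.one_apply]
      have hiff : r + p * i = s + p * j ↔ r = s ∧ i = j := by
        refine ⟨fun h => ⟨Fin.ext ?_, ?_⟩, fun h => by rw [h.1, h.2]⟩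
        · rw [← add_mul_mod_left p r i, h, add_mul_mod_left]
        · rw [← add_mul_div_left p r i, h, add_mul_div_left]
      simp only [hiff]
      by_cases hrs : r = s
      · simp only [hrs, if_true, true_and]
        exact (entry_one (R := R) i j).symm
      · simp only [hrs, if_false, false_and]
        rfl)
    (fun x y => by
      refine Matrix.ext fun r s => Subtype.ext ?_
      change component p r s (x.1 * y.1) = (T F p R).val (∑ t, _ * _)
      rw [component_mul, map_sum]
      rfl)

theorem componentHom_injective : Function.Injective (componentHom F p R) := by
  intro x y h
  ext i j
  -- The entry at `(i, j)` sits in the component of the residues, at the position given by the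
  -- quotients.
  have h1 := congrArg (fun z : T F p R => z.1.entry (i / p) (j / p))
    (congrFun (congrFun h (Fin.ofNat p i)) (Fin.ofNat p j))
  change x.1.entry (i % p + p * (i / p)) (j % p + p * (j / p))
    = y.1.entry (i % p + p * (i / p)) (j % p + p * (j / p)) at h1
  rwa [Nat.mod_add_div, Nat.mod_add_div] at h1

theorem componentHom_surjective : Function.Surjective (componentHom F p R) := by
  intro M
  refine ⟨∑ r, ∑ s, ⟨inflate p r s (M r s).1, inflate_mem_T F p (M r s).2 r s⟩, ?_⟩
  simp only [map_sum]
  conv_rhs => rw [Matrix.matrix_eq_sum_single M]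
  refine Finset.sum_congr rfl fun r _ => Finset.sum_congr rfl fun s _ => ?_
  refine Matrix.ext fun r' s' => Subtype.ext ?_
  refine (component_inflate p r s r' s' (M r s).1).trans ?_
  simp only [Matrix.single_apply]
  split_ifs <;> rfl

variable (R) in
/-- `T(R) ≅ M_p(T(R))`. -/
def componentEquiv : T F p R ≃ₐ[F] Matrix (Fin p) (Fin p) (T F p R) :=
  AlgEquiv.ofBijective (componentHom F p R)
    ⟨componentHom_injective F p, componentHom_surjective F p⟩

end Components

/-! ### Idempotents with one-dimensional corner. -/

section MinimalIdempotent

/-- A nonzero idempotent `e` whose corner `e * A * e` is one-dimensional over `F`. -/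
structure IsRankOneIdempotent (F : Type*) {A : Type*} [CommRing F] [Ring A] [Algebra F A] (e : A) :
    Prop where
  ne_zero : e ≠ 0
  idem : e * e = e
  corner : ∀ x, ∃ c : F, e * x * e = c • e

theorem IsRankOneIdempotent.map {F A B : Type*} [CommRing F] [Ring A] [Algebra F A] [Ring B]
    [Algebra F B] {e : A} (he : IsRankOneIdempotent F e) (f : A ≃ₐ[F] B) :
    IsRankOneIdempotent F (f e) where
  ne_zero := (map_ne_zero_iff f f.injective).2 he.ne_zero
  idem := by rw [← map_mul, he.idem]
  corner x := by
    obtain ⟨c, hc⟩ := he.corner (f.symm x)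
    exact ⟨c, by rw [← map_smul, ← hc, map_mul, map_mul, f.apply_symm_apply]⟩

/-- An idempotent with one-dimensional corner does not commute with a unital copy of `M_n(F)`,
for `n ≥ 2`. -/
theorem IsRankOneIdempotent.not_commute_matrix {F A n : Type*} [Field F] [Ring A] [Algebra F A]
    [Fintype n] [DecidableEq n] [Nontrivial n] {e : A} (he : IsRankOneIdempotent F e)
    (f : Matrix n n F →ₐ[F] A) : ¬ ∀ b, Commute (f b) e := by
  intro hcomm
  -- By commutation `f b * e = e * f b * e` is a scalar multiple of `e`; for an off-diagonal matrix
  -- unit the square is zero, so the scalar is zero.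
  have hoff : ∀ i j : n, i ≠ j → f (Matrix.single i j 1) * e = 0 := fun i j hij => by
    obtain ⟨c, hc⟩ := he.corner (f (Matrix.single i j 1))
    rw [(hcomm _).symm.eq, mul_assoc, he.idem] at hc
    have hsq : f (Matrix.single i j 1) * (f (Matrix.single i j 1) * e) = 0 := by
      rw [← mul_assoc, ← map_mul, Matrix.single_mul_single_of_ne _ _ _ _ hij.symm, map_zero,
        zero_mul]
    rw [hc, mul_smul_comm, hc, smul_smul] at hsq
    have hc0 : c = 0 := mul_self_eq_zero.1 ((smul_eq_zero.1 hsq).resolve_right he.ne_zero)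
    rw [hc, hc0, zero_smul]
  have hdiag : ∀ i : n, f (Matrix.single i i 1) * e = 0 := fun i => by
    obtain ⟨j, hj⟩ := exists_ne i
    have hprod : (Matrix.single i i 1 : Matrix n n F) = Matrix.single i j 1 * Matrix.single j i 1 := by
      rw [Matrix.single_mul_single_same, one_mul]
    rw [hprod, map_mul, mul_assoc, hoff j i hj, mul_zero]
  apply he.ne_zero
  rw [← one_mul e, ← map_one f, ← Matrix.sum_single_one, map_sum, Finset.sum_mul]
  exact Finset.sum_eq_zero fun i _ => hdiag i

/-- The matrix unit with entry `1` at `(0, 0)`. -/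
def RCFMatrix.corner (R : Type*) [Ring R] : RCFMatrix R :=
  ⟨Matrix.single 0 0 1, fun i => (Set.finite_singleton 0).subset fun j hj => by
      by_contra h; exact hj (Matrix.single_apply_of_col_ne _ _ (Ne.symm h) _),
    fun j => (Set.finite_singleton 0).subset fun i hi => by
      by_contra h; exact hi (Matrix.single_apply_of_row_ne (Ne.symm h) _ _ _)⟩

theorem RCFMatrix.entry_corner (R : Type*) [Ring R] (i j : ℕ) :
    (corner R).entry i j = if 0 = i ∧ 0 = j then 1 else 0 := Matrix.single_apply ..

theorem RCFMatrix.isFinite_corner (R : Type*) [Ring R] : (corner R).IsFinite :=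
  (Set.finite_singleton (0, 0)).subset fun q hq => by
    obtain ⟨h1, h2⟩ := (ite_ne_right_iff.1 ((entry_corner R q.1 q.2).symm.trans_ne hq)).1
    exact Prod.ext h1.symm h2.symm

theorem RCFMatrix.corner_mul_mul_corner {F : Type*} [CommRing F] (x : RCFMatrix F) :
    corner F * x * corner F = x.entry 0 0 • corner F := by
  have hzero : ∀ {i j}, (corner F).entry i j ≠ 0 → 0 = i ∧ 0 = j := fun {i j} h =>
    (ite_ne_right_iff.1 ((entry_corner F i j).symm.trans_ne h)).1
  ext i j
  rw [entry_mul_eq_sum _ _ i j {0} (fun l _ h => by simp [(hzero h).1.symm]),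
    Finset.sum_singleton,
    entry_mul_eq_sum _ _ i 0 {0} (fun l h _ => by simp [(hzero h).2.symm]),
    Finset.sum_singleton, entry_smul]
  simp only [entry_corner]
  by_cases hi : 0 = i <;> by_cases hj : 0 = j <;> simp [hi, hj]

theorem exists_isRankOneIdempotent_T (F : Type*) [Field F] (p : ℕ) [NeZero p] :
    ∃ e : T F p F, IsRankOneIdempotent F e := by
  refine ⟨⟨RCFMatrix.corner F, _, 0, RCFMatrix.isFinite_corner F,
    by simpa using RCFMatrix.isRecurrent_algebraMap (R := F) p (0 : F), (add_zero _).symm⟩,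
    fun h => ?_, ?_, fun x => ⟨x.1.entry 0 0, ?_⟩⟩
  · have h1 := congrArg (fun z : T F p F => z.1.entry 0 0) h
    exact one_ne_zero h1
  -- Idempotency is the corner formula at `x = 1`, whose `(0, 0)` entry is `1`.
  · ext : 1
    have h1 := RCFMatrix.corner_mul_mul_corner (1 : RCFMatrix F)
    rw [mul_one, RCFMatrix.entry_one, if_pos rfl, one_smul] at h1
    exact h1
  · ext : 1
    exact RCFMatrix.corner_mul_mul_corner x.1

end MinimalIdempotent

/-! ### Centralizers of the finite stages of M_{p^∞}(F). -/

section Commutant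

variable (F : Type*) [CommRing F] (p : ℕ) [NeZero p]

/-- `Fin p × Fin (p ^ k)` as the index type of `M_{p^(k+1)}`, the first coordinate numbering the
diagonal blocks of size `p ^ k`. -/
def blockIndexEquiv (k : ℕ) : Fin p × Fin (p ^ k) ≃ Fin (p ^ (k + 1)) :=
  finProdFinEquiv.trans (finCongr (pow_succ' p k).symm)

/-- The embedding of `M_p(F)` into `M_{p^(k+1)}(F)` as the centralizer of `M_{p^k}(F)`. -/
def commutantHom (k : ℕ) :
    Matrix (Fin p) (Fin p) F →ₐ[F] Matrix (Fin (p ^ (k + 1))) (Fin (p ^ (k + 1))) F :=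
  ((Matrix.reindexAlgEquiv F F (blockIndexEquiv p k)).toAlgHom.comp
    (Matrix.kroneckerAlgEquiv (Fin p) (Fin (p ^ k)) F).toAlgHom).comp
      Algebra.TensorProduct.includeLeft

/-- Under M_{p^(k+1)} ≅ M_p ⊗ M_{p^k} the diagonal embedding becomes a ↦ 1 ⊗ a, which visibly
commutes with every b ⊗ 1. -/
theorem transition_succ_eq (k : ℕ) (a : Matrix (Fin (p ^ k)) (Fin (p ^ k)) F) :
    transition F p k (k + 1) k.le_succ a
      = Matrix.reindexAlgEquiv F F (blockIndexEquiv p k) (1 ⊗ₖ a) := by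
  ext i j
  obtain ⟨⟨u, i⟩, rfl⟩ := (blockIndexEquiv p k).surjective i
  obtain ⟨⟨v, j⟩, rfl⟩ := (blockIndexEquiv p k).surjective j
  have hval : ∀ (t : Fin p) (l : Fin (p ^ k)), (blockIndexEquiv p k (t, l) : ℕ) = l + p ^ k * t :=
    fun _ _ => rfl
  have hmod : ∀ (t : ℕ) (l : Fin (p ^ k)), Fin.ofNat (p ^ k) (l + p ^ k * t) = l :=
    fun t l => Fin.ext (add_mul_mod_left (p ^ k) l t)
  change repeatEntry (p ^ k) a _ _ = _
  simp only [repeatEntry, hval, add_mul_div_left, hmod]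
  simp [Matrix.one_apply, Fin.val_inj]

theorem commute_commutantHom (k : ℕ) (b : Matrix (Fin p) (Fin p) F)
    (a : Matrix (Fin (p ^ k)) (Fin (p ^ k)) F) :
    Commute (commutantHom F p k b) (transition F p k (k + 1) k.le_succ a) := by
  have hb : commutantHom F p k b
      = Matrix.reindexAlgEquiv F F (blockIndexEquiv p k) (b ⊗ₖ 1) := by
    simp [commutantHom]
  rw [transition_succ_eq, hb]
  refine Commute.map ?_ _
  rw [commute_iff_eq, ← Matrix.mul_kronecker_mul, ← Matrix.mul_kronecker_mul, mul_one, one_mul,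
    mul_one, one_mul]

/-- The canonical map `M_{p^k}(F) → M_{p^∞}(F)`. -/
def stageHom (k : ℕ) : Matrix (Fin (p ^ k)) (Fin (p ^ k)) F →ₐ[F] SupernaturalMatrix F p :=
  DirectLimit.Algebra.of (fun k => Matrix (Fin (p ^ k)) (Fin (p ^ k)) F) (transition F p) k

theorem stageHom_transition {k l : ℕ} (h : k ≤ l) (a : Matrix (Fin (p ^ k)) (Fin (p ^ k)) F) :
    stageHom F p l (transition F p k l h a) = stageHom F p k a :=
  DirectLimit.Algebra.of_f (f := transition F p) h a

/-- An element of `M_{p^∞}(F) ⊗ A` lives at a finite stage, so it commutes with `u ⊗ 1` for every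
`u` in the centralizer of that stage. -/
theorem exists_stage_commute {A : Type*} [Ring A] [Algebra F A] (t : SupernaturalMatrix F p ⊗[F] A) :
    ∃ k, ∀ u : SupernaturalMatrix F p, (∀ a, Commute u (stageHom F p k a)) →
      Commute (u ⊗ₜ[F] (1 : A)) t := by
  induction t using TensorProduct.induction_on with
  | zero => exact ⟨0, fun u _ => Commute.zero_right _⟩
  | tmul x y =>
    obtain ⟨k, a, rfl⟩ := DirectLimit.exists_eq_mk _ x
    refine ⟨k, fun u hu => ?_⟩
    have hcomm : u * ⟦⟨k, a⟩⟧ = ⟦⟨k, a⟩⟧ * u := (hu a).eq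
    rw [commute_iff_eq, Algebra.TensorProduct.tmul_mul_tmul, Algebra.TensorProduct.tmul_mul_tmul,
      one_mul, mul_one]
    exact congrArg (· ⊗ₜ[F] y) hcomm
  | add s t hs ht =>
    obtain ⟨k, hk⟩ := hs
    obtain ⟨l, hl⟩ := ht
    -- The images of the stages increase, so commuting with stage `max k l` implies commuting with
    -- stages `k` and `l`.
    refine ⟨max k l, fun u hu => (hk u fun a => ?_).add_right (hl u fun a => ?_)⟩
    · rw [← stageHom_transition F p (le_max_left k l)]; exact hu _
    · rw [← stageHom_transition F p (le_max_right k l)]; exact hu _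

theorem not_isRankOneIdempotent_tensor (F : Type*) [Field F] (p : ℕ) [Fact p.Prime] {A : Type*}
    [Ring A] [Algebra F A] (e : SupernaturalMatrix F p ⊗[F] A) : ¬ IsRankOneIdempotent F e := by
  intro he
  obtain ⟨k, hk⟩ := exists_stage_commute F p e
  have : Nontrivial (Fin p) := Fin.nontrivial_iff_two_le.2 (Fact.out : p.Prime).two_le
  refine he.not_commute_matrix (Algebra.TensorProduct.includeLeft.comp
    ((stageHom F p (k + 1)).comp (commutantHom F p k))) fun b => hk _ fun a => ?_
  rw [← stageHom_transition F p k.le_succ]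
  exact (commute_commutantHom F p k b a).map (stageHom F p (k + 1))

end Commutant

end Supernatural

end

theorem mainTheorem4 (F : Type*) [Field F] (p : ℕ) [Fact p.Prime] :
    Nonempty ((Matrix (Fin p) (Fin p) F ⊗[F] Supernatural.T F p F) ≃ₐ[F]
      Supernatural.T F p F) ∧
    Nonempty (Matrix (Fin p) (Fin p) (Supernatural.T F p F) ≃ₐ[F] Supernatural.T F p F) ∧
    IsEmpty ((Supernatural.SupernaturalMatrix F p ⊗[F] Supernatural.T F p F) ≃ₐ[F]
      Supernatural.T F p F) := by
  have e := (Supernatural.componentEquiv F p F).symm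
  refine ⟨⟨(Algebra.TensorProduct.comm F _ _).trans
    ((matrixEquivTensor (Fin p) F (Supernatural.T F p F)).symm.trans e)⟩, ⟨e⟩, ⟨fun f => ?_⟩⟩
  obtain ⟨x, hx⟩ := Supernatural.exists_isRankOneIdempotent_T F p
  exact Supernatural.not_isRankOneIdempotent_tensor F p _ (hx.map f.symm)
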